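/- Let $\Gamma$ be a set of colours. A (vertex-coloured) graph $G$ consists of a finite vertex set $V(G)$, a set $E(G)\subseteq\binom{V(G)}{2}$ of edges and a colouring $\gamma^G:V(G)\to\Gamma$. A homomorphism from $F$ to $G$ is a map $h:V(F)\to V(G)$ such that $h(u)h(v)\in E(G)$ for all $uv\in E(F)$ and $\gamma^F(u)=\gamma^G(h(u))$ for all $u\in V(F)$; $\hom(F,G)$ is the number of these maps. A forest on a finite set $V$ is a partial order $\preceq$ on $V$ such that for every $t\in V$ the set $\{u\in V : u\preceq t\}$ is a chain; its height is the number of elements of a longest chain. An elimination forest of $F$ is a forest on $V(F)$ such that $u\preceq v$ or $v\preceq u$ for every edge $uv\in E(F)$. The tree depth of $F$ is the minimum height of an elimination forest of $F$. The formulas of first-order logic with counting $\mathsf{C}$ are built from the atomic formulas $x=y$, $E(x,y)$ and $\gamma(x)=c$ ($c\in\Gamma$), where $x,y$ come from an infinite supply of variables ranging over vertices, by negation, disjunction and the counting quantifiers $\exists^{\ge p}x$ ($p\in\mathbb{N}$), where $\exists^{\ge p}x\,\varphi$ means that there are at least $p$ distinct vertices $x$ that satisfy $\varphi$. A sentence is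 a formula without free variables. The quantifier rank of a formula is the maximum number of nested quantifiers in it. **Theorem.** For every $k\ge 1$ and all vertex-coloured graphs $G,G'$ with colours in $\Gamma$, the following are equivalent: 1. $\hom(F,G)=\hom(F,G')$ for every vertex-coloured graph $F$ (with colours in $\Gamma$) of tree depth at most $k$; 2. $G$ and $G'$ satisfy the same $\mathsf{C}$-sentences of quantifier rank at most $k$. -/

import Mathlib

universe u v v' w

namespace TDHom

/-- A finite, undirected, loop-free graph whose vertices are coloured by elements of `Γ`. -/
structure ColouredGraph (Γ : Type u) where
  /-- the vertex set -/
  V : Type v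
  finite_V : Finite V
  /-- the edge relation -/
  graph : SimpleGraph V
  /-- the colouring -/
  colour : V → Γ

attribute [instance] ColouredGraph.finite_V

/-- Homomorphisms of coloured graphs preserve adjacency and colours. -/
structure IsHom {Γ : Type u} (F : ColouredGraph.{u, w} Γ) (G : ColouredGraph.{u, v} Γ)
    (h : F.V → G.V) : Prop where
  map_adj : ∀ a b : F.V, F.graph.Adj a b → G.graph.Adj (h a) (h b)
  map_colour : ∀ a : F.V, F.colour a = G.colour (h a)

/-- The number of homomorphisms from `F` to `G`. -/
noncomputable def homCount {Γ : Type u} (F : ColouredGraph.{u, w} Γ)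
    (G : ColouredGraph.{u, v} Γ) : ℕ :=
  Nat.card {h : F.V → G.V // IsHom F G h}

/-- `G` and `G'` are homomorphism-indistinguishable over the class `𝓕` of graphs. -/
def HomIndistinguishable {Γ : Type u} (𝓕 : Set (ColouredGraph.{u, w} Γ))
    (G : ColouredGraph.{u, v} Γ) (G' : ColouredGraph.{u, v'} Γ) : Prop :=
  ∀ F ∈ 𝓕, homCount F G = homCount F G'

/-- A forest on the vertex set `V`: a partial order all of whose principal down-sets are
chains. -/
structure Forest (V : Type w) where
  le : V → V → Prop
  isPartialOrder : IsPartialOrder V le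
  isChain_down : ∀ t : V, IsChain le {x | le x t}

/-- The height of a forest: the largest number of elements of a chain. -/
noncomputable def Forest.height {V : Type w} (S : Forest V) : ℕ :=
  sSup {n : ℕ | ∃ X : Finset V, IsChain S.le (X : Set V) ∧ X.card = n}

/-- `S` is an elimination forest of `F`: any two adjacent vertices are comparable in `S`. -/
def IsEliminationForest {Γ : Type u} (F : ColouredGraph.{u, w} Γ) (S : Forest F.V) : Prop :=
  ∀ a b : F.V, F.graph.Adj a b → S.le a b ∨ S.le b a

/-- The tree depth of `F`: the least height of an elimination forest of `F`. -/
noncomputable def treeDepth {Γ : Type u} (F : ColouredGraph.{u, w} Γ) : ℕ :=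
  sInf {d : ℕ | ∃ S : Forest F.V, IsEliminationForest F S ∧ S.height = d}

/-- The supremum defining the height is over a bounded set, hence a maximum. -/
theorem Forest.bddAbove_chains {V : Type w} [Finite V] (S : Forest V) :
    BddAbove {n : ℕ | ∃ X : Finset V, IsChain S.le (X : Set V) ∧ X.card = n} := by
  classical
  have := Fintype.ofFinite V
  refine ⟨Fintype.card V, ?_⟩
  rintro n ⟨X, -, rfl⟩
  exact X.card_le_univ

/-- Every graph has an elimination forest, so that the tree depth is an actual minimum. -/
theorem exists_isEliminationForest {Γ : Type u} (F : ColouredGraph.{u, w} Γ) :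
    ∃ S : Forest F.V, IsEliminationForest F S := by
  obtain ⟨n, ⟨e⟩⟩ := Finite.exists_equiv_fin F.V
  refine ⟨⟨fun a b => e a ≤ e b,
    { refl := fun a => le_refl (e a)
      trans := fun a b c => le_trans
      antisymm := fun a b h h' => e.injective (le_antisymm h h') },
    fun t a _ b _ _ => le_total (e a) (e b)⟩, fun a b _ => le_total (e a) (e b)⟩

/-- The class of all graphs of tree depth at most `k`. -/
def TD (Γ : Type u) (k : ℕ) : Set (ColouredGraph.{u, w} Γ) :=
  {F | treeDepth F ≤ k}

/-- Formulas of first-order logic with counting quantifiers, in the language of graphs with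
vertex colours from `Γ`. Variables are indexed by natural numbers. -/
inductive Formula (Γ : Type u) : Type u
  | /-- `x = y` -/ eq (x y : ℕ) : Formula Γ
  | /-- `E(x, y)` -/ edge (x y : ℕ) : Formula Γ
  | /-- `γ(x) = c` -/ hasColour (x : ℕ) (c : Γ) : Formula Γ
  | /-- `¬ φ` -/ neg (φ : Formula Γ) : Formula Γ
  | /-- `φ ∨ ψ` -/ disj (φ ψ : Formula Γ) : Formula Γ
  | /-- `∃^{≥ p} x φ` -/ existsGE (p x : ℕ) (φ : Formula Γ) : Formula Γ

namespace Formula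

/-- The free variables of a formula. -/
def freeVars {Γ : Type u} : Formula Γ → Finset ℕ
  | eq x y => {x, y}
  | edge x y => {x, y}
  | hasColour x _ => {x}
  | neg φ => φ.freeVars
  | disj φ ψ => φ.freeVars ∪ ψ.freeVars
  | existsGE _ x φ => φ.freeVars.erase x

/-- A sentence is a formula without free variables. -/
def IsSentence {Γ : Type u} (φ : Formula Γ) : Prop := φ.freeVars = ∅

/-- The quantifier rank of a formula. -/
def qr {Γ : Type u} : Formula Γ → ℕ
  | eq _ _ => 0
  | edge _ _ => 0
  | hasColour _ _ => 0
  | neg φ => φ.qr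
  | disj φ ψ => max φ.qr ψ.qr
  | existsGE _ _ φ => φ.qr + 1

/-- Satisfaction of a formula in `G` under a partial assignment `a` of vertices to variables.
It is meant for assignments that are defined on all free variables of the formula. Partial
assignments are used because the empty graph has no total ones. -/
def Sat {Γ : Type u} (G : ColouredGraph.{u, v} Γ) : (ℕ → Option G.V) → Formula Γ → Prop
  | a, eq x y => ∃ b : G.V, a x = some b ∧ a y = some b
  | a, edge x y => ∃ b c : G.V, a x = some b ∧ a y = some c ∧ G.graph.Adj b c
  | a, hasColour x c => ∃ b : G.V, a x = some b ∧ G.colour b = c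
  | a, neg φ => ¬ Sat G a φ
  | a, disj φ ψ => Sat G a φ ∨ Sat G a ψ
  | a, existsGE p x φ => ∃ b : Fin p → G.V, Function.Injective b ∧
      ∀ i : Fin p, Sat G (Function.update a x (some (b i))) φ

/-- Satisfaction depends only on the values of the free variables. -/
theorem sat_congr {Γ : Type u} (G : ColouredGraph.{u, v} Γ) (φ : Formula Γ) :
    ∀ a b : ℕ → Option G.V, (∀ x ∈ φ.freeVars, a x = b x) → (Sat G a φ ↔ Sat G b φ) := by
  induction φ with
  | eq x y => intro a b h; simp [freeVars] at h; simp [Sat, h]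
  | edge x y => intro a b h; simp [freeVars] at h; simp [Sat, h]
  | hasColour x c => intro a b h; simp [freeVars] at h; simp [Sat, h]
  | neg φ ih => intro a b h; simp only [Sat]; rw [ih a b h]
  | disj φ ψ ih₁ ih₂ =>
    intro a b h
    simp only [Sat]
    rw [ih₁ a b fun x hx => h x (Finset.mem_union_left _ hx),
      ih₂ a b fun x hx => h x (Finset.mem_union_right _ hx)]
  | existsGE p x φ ih =>
    intro a b h
    simp only [Sat]
    refine exists_congr fun f => and_congr_right fun _ => forall_congr' fun i => ih _ _ ?_
    intro y hy
    by_cases hyx : y = x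
    · subst hyx; simp
    · simp only [Function.update_of_ne hyx]
      exact h y (Finset.mem_erase.2 ⟨hyx, hy⟩)

end Formula

/-- `G ⊨ φ` for a sentence `φ`: no variable needs a value. -/
def Models {Γ : Type u} (G : ColouredGraph.{u, v} Γ) (φ : Formula Γ) : Prop :=
  Formula.Sat G (fun _ => none) φ

/-- `G` and `G'` satisfy the same sentences of quantifier rank at most `k`. -/
def CEquivalent {Γ : Type u} (k : ℕ) (G : ColouredGraph.{u, v} Γ)
    (G' : ColouredGraph.{u, v'} Γ) : Prop :=
  ∀ φ : Formula Γ, φ.IsSentence → φ.qr ≤ k → (Models G φ ↔ Models G' φ)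

end TDHom

/-! Both conditions are equivalent to Duplicator winning the `k`-round bijective game
(`game_iff_cEquivalent`, `game_iff_homIndistinguishable`). A counting quantifier, or a root of an
elimination forest, costs one round: the bijection of that round matches the witnesses, or the
images of the root. This gives `Game.sat_iff` and `Game.count_eq`.

Conversely, Duplicator needs a bijection between vertices that look alike to all formulas of smaller
rank, or to all labelled graphs of smaller depth. Truth values, or homomorphism counts, as functions
of the new vertex form a family of pairs of functions on `G.V` and `G'.V`. It is closed under
products (conjunction, or disjoint union over shared labels), and paired functions have equal sums,
because summing over the new vertex amounts to quantifying it, or to turning its label into a root.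
Interpolation then yields the bijection (`exists_equiv_of_sum_eq`). Equality of vertices is a
formula but is not seen by homomorphisms, so for graphs the bijection is corrected to respect the
vertices already chosen (`exists_equiv_extending`). -/

namespace TDHom

/-! ### Bijections from equality of sums -/

/-- A multiplicatively closed family of pairs of functions with equal sums stays balanced after
multiplication with finitely many shifted members of the family. -/
theorem sum_mul_prod_sub_eq {A B : Type*} [Fintype A] [Fintype B] {ι : Type*}
    (P : (A → ℤ) → (B → ℤ) → Prop)
    (hmul : ∀ f g f' g', P f g → P f' g' → P (f * f') (g * g'))
    (hsum : ∀ f g, P f g → ∑ a, f a = ∑ b, g b)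
    (F : ι → A → ℤ) (F' : ι → B → ℤ) (hF : ∀ i, P (F i) (F' i)) (β : ι → ℤ) (Y : Finset ι) :
    ∀ f g, P f g →
      ∑ a, f a * ∏ i ∈ Y, (F i a - β i) = ∑ b, g b * ∏ i ∈ Y, (F' i b - β i) := by
  classical
  induction Y using Finset.induction_on with
  | empty => intro f g h; simpa using hsum f g h
  | insert i Y hi ih =>
    intro f g h
    have h1 := ih _ _ (hmul _ _ _ _ h (hF i))
    have h2 := ih _ _ h
    simp only [Finset.prod_insert hi]
    have e1 : ∀ a, f a * ((F i a - β i) * ∏ j ∈ Y, (F j a - β j)) =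
        (f * F i) a * ∏ j ∈ Y, (F j a - β j) - β i * (f a * ∏ j ∈ Y, (F j a - β j)) := by
      intro a; simp only [Pi.mul_apply]; ring
    have e2 : ∀ b, g b * ((F' i b - β i) * ∏ j ∈ Y, (F' j b - β j)) =
        (g * F' i) b * ∏ j ∈ Y, (F' j b - β j) - β i * (g b * ∏ j ∈ Y, (F' j b - β j)) := by
      intro b; simp only [Pi.mul_apply]; ring
    simp only [e1, e2, Finset.sum_sub_distrib, ← Finset.mul_sum, h1, h2]

/-- The values at a point of `A ⊕ B` of all pairs in a family. -/
def profile {A B : Type*} (P : (A → ℤ) → (B → ℤ) → Prop) (x : A ⊕ B) :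
    {p : (A → ℤ) × (B → ℤ) // P p.1 p.2} → ℤ :=
  fun p => Sum.elim p.1.1 p.1.2 x

/-- Interpolation: a product of shifted family members vanishes exactly off the class of `x` and is
constant on that class, so equal sums force equal class sizes. -/
theorem card_profile_eq {A B : Type*} [Fintype A] [Fintype B]
    (P : (A → ℤ) → (B → ℤ) → Prop)
    (hmul : ∀ f g f' g', P f g → P f' g' → P (f * f') (g * g'))
    (hsum : ∀ f g, P f g → ∑ a, f a = ∑ b, g b)
    (x : A ⊕ B) (hx : ∃ p, profile P x p ≠ 0) :
    Nat.card {a : A // profile P (.inl a) = profile P x} =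
      Nat.card {b : B // profile P (.inr b) = profile P x} := by
  classical
  obtain ⟨p₀, hp₀⟩ := hx
  have hsep : ∀ y : {y : A ⊕ B // profile P y ≠ profile P x},
      ∃ p, profile P y.1 p ≠ profile P x p := fun y => Function.ne_iff.1 y.2
  choose s hs using hsep
  -- The family need not contain constants. The leading factor `p₀` makes every term of the expanded
  -- product a multiple of a family member.
  set W : A ⊕ B → ℤ := fun z => profile P z p₀ *
    ∏ y : {y : A ⊕ B // profile P y ≠ profile P x}, (profile P z (s y) - profile P y.1 (s y))
    with hW
  have hbal : ∑ a, W (.inl a) = ∑ b, W (.inr b) :=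
    sum_mul_prod_sub_eq P hmul hsum (fun y => (s y).1.1) (fun y => (s y).1.2)
      (fun y => (s y).2) (fun y => profile P y.1 (s y)) Finset.univ _ _ p₀.2
  have hWx : W x ≠ 0 := mul_ne_zero hp₀
    (Finset.prod_ne_zero_iff.2 fun y _ => sub_ne_zero.2 (hs y).symm)
  have hWz : ∀ z, W z = if profile P z = profile P x then W x else 0 := by
    intro z
    split_ifs with h
    · simp only [hW, h]
    · exact mul_eq_zero_of_right _
        (Finset.prod_eq_zero (Finset.mem_univ ⟨z, h⟩) (sub_self _))
  rw [Finset.sum_congr rfl fun a _ => hWz (.inl a), Finset.sum_congr rfl fun b _ => hWz (.inr b),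
    ← Finset.sum_filter, ← Finset.sum_filter, Finset.sum_const, Finset.sum_const, nsmul_eq_mul,
    nsmul_eq_mul] at hbal
  have := mul_right_cancel₀ hWx hbal
  rw [Nat.card_eq_fintype_card, Nat.card_eq_fintype_card, Fintype.card_subtype,
    Fintype.card_subtype]
  exact_mod_cast this

theorem exists_equiv_of_card_fiber_eq {A B K : Type*} [Finite A] [Finite B]
    (f : A → K) (g : B → K)
    (h : ∀ c, Nat.card {a // f a = c} = Nat.card {b // g b = c}) :
    ∃ π : A ≃ B, ∀ a, g (π a) = f a := by
  have e : ∀ c, Nonempty ({a // f a = c} ≃ {b // g b = c}) := fun c =>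
    (Finite.card_eq.1 (h c))
  let π : A ≃ B := ((Equiv.sigmaFiberEquiv f).symm.trans
    (Equiv.sigmaCongrRight fun c => (e c).some)).trans (Equiv.sigmaFiberEquiv g)
  exact ⟨π, fun a => ((e (f a)).some ⟨a, rfl⟩).2⟩

/-- If a multiplicatively closed family of pairs of functions on `A` and `B` has equal sums, then
some bijection between `A` and `B` respects all members of the family. -/
theorem exists_equiv_of_sum_eq {A B : Type*} [Fintype A] [Fintype B]
    (P : (A → ℤ) → (B → ℤ) → Prop)
    (hmul : ∀ f g f' g', P f g → P f' g' → P (f * f') (g * g'))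
    (hsum : ∀ f g, P f g → ∑ a, f a = ∑ b, g b)
    (hA : ∀ a, ∃ f g, P f g ∧ f a ≠ 0) (hB : ∀ b, ∃ f g, P f g ∧ g b ≠ 0) :
    ∃ π : A ≃ B, ∀ f g, P f g → ∀ a, f a = g (π a) := by
  obtain ⟨π, hπ⟩ := exists_equiv_of_card_fiber_eq (fun a : A => profile P (.inl a))
    (fun b : B => profile P (.inr b)) (by
      intro c
      by_cases hc : ∃ x, profile P x = c
      · obtain ⟨x, rfl⟩ := hc
        refine card_profile_eq P hmul hsum x ?_
        rcases x with a | b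
        · obtain ⟨f, g, h, hne⟩ := hA a
          exact ⟨⟨(f, g), h⟩, hne⟩
        · obtain ⟨f, g, h, hne⟩ := hB b
          exact ⟨⟨(f, g), h⟩, hne⟩
      · have h1 : IsEmpty {a : A // profile P (.inl a) = c} := ⟨fun a => hc ⟨_, a.2⟩⟩
        have h2 : IsEmpty {b : B // profile P (.inr b) = c} := ⟨fun b => hc ⟨_, b.2⟩⟩
        simp)
  exact ⟨π, fun f g h a => (congrFun (hπ a) ⟨(f, g), h⟩).symm⟩

/-- A bijection respecting a key can be changed so that it extends a given partial injection
respecting the key. -/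
theorem exists_equiv_extending {A B K ι : Type*} [Finite ι] (f : A → K) (g : B → K)
    (π : A ≃ B) (hπ : ∀ a, g (π a) = f a) (a : ι → A) (b : ι → B)
    (hab : ∀ i j, a i = a j ↔ b i = b j) (hk : ∀ i, g (b i) = f (a i)) :
    ∃ π' : A ≃ B, (∀ a, g (π' a) = f a) ∧ ∀ i, π' (a i) = b i := by
  classical
  have := Fintype.ofFinite ι
  suffices h : ∀ s : Finset ι, ∃ π' : A ≃ B, (∀ a, g (π' a) = f a) ∧ ∀ i ∈ s, π' (a i) = b i by
    obtain ⟨π', h1, h2⟩ := h Finset.univ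
    exact ⟨π', h1, fun i => h2 i (Finset.mem_univ i)⟩
  intro s
  induction s using Finset.induction_on with
  | empty => exact ⟨π, hπ, by simp⟩
  | insert i s _ ih =>
    obtain ⟨ρ, h1, h2⟩ := ih
    -- The two swapped points have the same key, and neither is `b j` for an earlier `j` with `a j ≠
    -- a i`.
    refine ⟨ρ.trans (Equiv.swap (ρ (a i)) (b i)), fun x => ?_, fun j hj => ?_⟩
    · rw [Equiv.trans_apply, ← h1 x]
      by_cases e1 : ρ x = ρ (a i)
      · rw [e1, Equiv.swap_apply_left, hk, h1]
      · by_cases e2 : ρ x = b i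
        · rw [e2, Equiv.swap_apply_right, h1, hk]
        · rw [Equiv.swap_apply_of_ne_of_ne e1 e2]
    · rw [Equiv.trans_apply]
      by_cases e : a j = a i
      · rw [e, Equiv.swap_apply_left, (hab j i).1 e]
      · have hjs : j ∈ s := (Finset.mem_insert.1 hj).resolve_left fun h => e (h ▸ rfl)
        have h3 : ρ (a j) ≠ ρ (a i) := fun h => e (ρ.injective h)
        have h4 : ρ (a j) ≠ b i := by rw [h2 j hjs]; exact fun h => e ((hab j i).2 h)
        rw [Equiv.swap_apply_of_ne_of_ne h3 h4, h2 j hjs]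

/-! ### The bijective game -/

noncomputable instance ColouredGraph.fintypeV {Γ : Type u} (G : ColouredGraph.{u, v} Γ) :
    Fintype G.V := Fintype.ofFinite G.V

section Game

variable {Γ : Type u} {G : ColouredGraph.{u, v} Γ} {G' : ColouredGraph.{u, v'} Γ}

/-- The two tuples satisfy the same atomic formulas. -/
def PartialIso {n : ℕ} (a : Fin n → G.V) (a' : Fin n → G'.V) : Prop :=
  (∀ i j, a i = a j ↔ a' i = a' j) ∧
  (∀ i j, G.graph.Adj (a i) (a j) ↔ G'.graph.Adj (a' i) (a' j)) ∧
  ∀ i, G.colour (a i) = G'.colour (a' i)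

/-- Duplicator wins the bijective game with `r` rounds from the given position. -/
def Game : ℕ → ∀ {n : ℕ}, (Fin n → G.V) → (Fin n → G'.V) → Prop
  | 0, _, a, a' => PartialIso a a'
  | r + 1, n, a, a' => PartialIso a a' ∧ ∃ π : G.V ≃ G'.V, ∀ v,
      Game r (Fin.cons v a : Fin (n + 1) → G.V) (Fin.cons (π v) a' : Fin (n + 1) → G'.V)

theorem Game.partialIso {r n : ℕ} {a : Fin n → G.V} {a' : Fin n → G'.V} (h : Game r a a') :
    PartialIso a a' := by
  cases r with
  | zero => exact h
  | succ r => exact h.1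

/-- The assignments agree up to the correspondence given by the two tuples. -/
def Matched {n : ℕ} (a : Fin n → G.V) (a' : Fin n → G'.V) (α : ℕ → Option G.V)
    (α' : ℕ → Option G'.V) : Prop :=
  ∀ x, (α x = none ∧ α' x = none) ∨ ∃ i, α x = some (a i) ∧ α' x = some (a' i)

theorem Matched.update {n : ℕ} {a : Fin n → G.V} {a' : Fin n → G'.V} {α : ℕ → Option G.V}
    {α' : ℕ → Option G'.V} (h : Matched a a' α α') (x : ℕ) (v : G.V) (v' : G'.V) :
    Matched (Fin.cons v a : Fin (n + 1) → G.V) (Fin.cons v' a' : Fin (n + 1) → G'.V)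
      (Function.update α x (some v)) (Function.update α' x (some v')) := by
  intro y
  by_cases hy : y = x
  · subst hy; exact Or.inr ⟨0, by simp⟩
  · simp only [Function.update_of_ne hy]
    exact (h y).imp_right fun ⟨i, hi⟩ => ⟨i.succ, by simpa using hi⟩

theorem Game.sat_iff (φ : Formula Γ) : ∀ {r n : ℕ} {a : Fin n → G.V} {a' : Fin n → G'.V}
    {α : ℕ → Option G.V} {α' : ℕ → Option G'.V}, Game r a a' → Matched a a' α α' → φ.qr ≤ r →
    (Formula.Sat G α φ ↔ Formula.Sat G' α' φ) := by
  induction φ with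
  | eq x y =>
    intro r n a a' α α' hg hm _
    have hp := hg.partialIso
    rcases hm x with ⟨h1, h2⟩ | ⟨i, h1, h2⟩ <;> rcases hm y with ⟨h3, h4⟩ | ⟨j, h3, h4⟩ <;>
      simp [Formula.Sat, h1, h2, h3, h4, hp.1]
  | edge x y =>
    intro r n a a' α α' hg hm _
    have hp := hg.partialIso
    rcases hm x with ⟨h1, h2⟩ | ⟨i, h1, h2⟩ <;> rcases hm y with ⟨h3, h4⟩ | ⟨j, h3, h4⟩ <;>
      simp [Formula.Sat, h1, h2, h3, h4, hp.2.1]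
  | hasColour x c =>
    intro r n a a' α α' hg hm _
    have hp := hg.partialIso
    rcases hm x with ⟨h1, h2⟩ | ⟨i, h1, h2⟩ <;> simp [Formula.Sat, h1, h2, hp.2.2]
  | neg φ ih =>
    intro r n a a' α α' hg hm hr
    exact not_congr (ih hg hm hr)
  | disj φ ψ ih₁ ih₂ =>
    intro r n a a' α α' hg hm hr
    exact or_congr (ih₁ hg hm (le_trans (le_max_left _ _) hr))
      (ih₂ hg hm (le_trans (le_max_right _ _) hr))
  | existsGE p x φ ih =>
    intro r n a a' α α' hg hm hr
    cases r with
    | zero => simp [Formula.qr] at hr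
    | succ r =>
      obtain ⟨-, π, hπ⟩ := hg
      have key : ∀ v, Formula.Sat G (Function.update α x (some v)) φ ↔
          Formula.Sat G' (Function.update α' x (some (π v))) φ := fun v =>
        ih (hπ v) (hm.update x v (π v)) (Nat.le_of_succ_le_succ hr)
      constructor
      · rintro ⟨b, hb, h⟩
        exact ⟨fun i => π (b i), π.injective.comp hb, fun i => (key _).1 (h i)⟩
      · rintro ⟨b, hb, h⟩
        refine ⟨fun i => π.symm (b i), π.symm.injective.comp hb, fun i => (key _).2 ?_⟩
        simpa using h i

/-- Counting quantifiers detect the number of witnesses. -/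
theorem sat_existsGE_iff (α : ℕ → Option G.V) (p x : ℕ) (φ : Formula Γ) :
    Formula.Sat G α (.existsGE p x φ) ↔
      p ≤ Nat.card {v : G.V // Formula.Sat G (Function.update α x (some v)) φ} := by
  constructor
  · rintro ⟨b, hb, h⟩
    have := Nat.card_le_card_of_injective
      (fun i : Fin p => (⟨b i, h i⟩ : {v : G.V // Formula.Sat G (Function.update α x (some v)) φ}))
      (fun i j hij => hb (congrArg Subtype.val hij))
    simpa using this
  · intro h
    let e := (Finite.equivFin {v : G.V // Formula.Sat G (Function.update α x (some v)) φ}).symm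
    exact ⟨fun i => (e (Fin.castLE h i)).1,
      Subtype.val_injective.comp (e.injective.comp (Fin.castLE_injective h)),
      fun i => (e (Fin.castLE h i)).2⟩

-- The functions are the truth values of formulas of rank at most `r` with free variables below `m +
-- 1`. The bound `m` keeps the variable `m` fresh, so it can name the vertex of the next round.
open Classical in
theorem game_of_sat_iff (r : ℕ) : ∀ {n m : ℕ} (a : Fin n → G.V) (a' : Fin n → G'.V)
    (α : ℕ → Option G.V) (α' : ℕ → Option G'.V),
    (∀ i, ∃ x < m, α x = some (a i) ∧ α' x = some (a' i)) →
    (∀ φ : Formula Γ, φ.freeVars ⊆ Finset.range m → φ.qr ≤ r →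
      (Formula.Sat G α φ ↔ Formula.Sat G' α' φ)) → Game r a a' := by
  have hiso : ∀ {r n m : ℕ} (a : Fin n → G.V) (a' : Fin n → G'.V)
    (α : ℕ → Option G.V) (α' : ℕ → Option G'.V),
    (∀ i, ∃ x < m, α x = some (a i) ∧ α' x = some (a' i)) →
    (∀ φ : Formula Γ, φ.freeVars ⊆ Finset.range m → φ.qr ≤ r →
      (Formula.Sat G α φ ↔ Formula.Sat G' α' φ)) → PartialIso a a' := by
    intro r n m a a' α α' hα hφ
    choose x hx hxa hxa' using hα
    refine ⟨fun i j => ?_, fun i j => ?_, fun i => ?_⟩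
    · simpa [Formula.Sat, hxa, hxa', eq_comm] using hφ (.eq (x i) (x j))
        (by simp [Formula.freeVars, Finset.insert_subset_iff, hx]) (Nat.zero_le _)
    · simpa [Formula.Sat, hxa, hxa'] using hφ (.edge (x i) (x j))
        (by simp [Formula.freeVars, Finset.insert_subset_iff, hx]) (Nat.zero_le _)
    · have := hφ (.hasColour (x i) (G.colour (a i)))
        (by simp [Formula.freeVars, hx]) (Nat.zero_le _)
      simp [Formula.Sat, hxa, hxa'] at this
      exact this.symm
  induction r with
  | zero => intro n m a a' α α' hα hφ; exact hiso a a' α α' hα hφ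
  | succ r ih =>
    intro n m a a' α α' hα hφ
    refine ⟨hiso a a' α α' hα hφ, ?_⟩
    obtain ⟨π, hπ⟩ := exists_equiv_of_sum_eq (A := G.V) (B := G'.V)
      (fun f g => ∃ φ : Formula Γ, φ.freeVars ⊆ Finset.range (m + 1) ∧ φ.qr ≤ r ∧
        (f = fun v => if Formula.Sat G (Function.update α m (some v)) φ then 1 else 0) ∧
        (g = fun v => if Formula.Sat G' (Function.update α' m (some v)) φ then 1 else 0))
      (by
        rintro _ _ _ _ ⟨φ, h1, h2, rfl, rfl⟩ ⟨ψ, h3, h4, rfl, rfl⟩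
        refine ⟨.neg (.disj (.neg φ) (.neg ψ)), Finset.union_subset h1 h3, max_le h2 h4, ?_, ?_⟩ <;>
        · funext v
          simp only [Pi.mul_apply, Formula.Sat, not_or, not_not, ite_and, mul_ite, mul_one,
            mul_zero]
          split_ifs <;> rfl)
      (by
        rintro _ _ ⟨φ, h1, h2, rfl, rfl⟩
        -- Quantifying the variable `m` raises the rank to at most `r + 1`; all thresholds `p`
        -- together determine the number of witnesses.
        have h : ∀ p, p ≤ Nat.card {v : G.V // Formula.Sat G (Function.update α m (some v)) φ} ↔
            p ≤ Nat.card {v : G'.V // Formula.Sat G' (Function.update α' m (some v)) φ} := by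
          intro p
          rw [← sat_existsGE_iff, ← sat_existsGE_iff]
          refine hφ _ (fun y hy => ?_) (Nat.succ_le_succ h2)
          obtain ⟨h5, h6⟩ := Finset.mem_erase.1 hy
          have := Finset.mem_range.1 (h1 h6)
          exact Finset.mem_range.2 (by omega)
        have hc := le_antisymm ((h _).1 le_rfl) ((h _).2 le_rfl)
        rw [Nat.card_eq_fintype_card, Nat.card_eq_fintype_card, Fintype.card_subtype,
          Fintype.card_subtype] at hc
        simp only [Finset.sum_boole]
        exact_mod_cast hc)
      -- A tautology supplies the constant function 1, so no vertex has zero profile.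
      (fun v => ⟨_, _, ⟨.eq m m, by simp [Formula.freeVars], Nat.zero_le _, rfl, rfl⟩,
        by simp [Formula.Sat]⟩)
      (fun v => ⟨_, _, ⟨.eq m m, by simp [Formula.freeVars], Nat.zero_le _, rfl, rfl⟩,
        by simp [Formula.Sat]⟩)
    refine ⟨π, fun v => ih (m := m + 1) _ _ (Function.update α m (some v))
      (Function.update α' m (some (π v))) ?_ ?_⟩
    · intro i
      refine Fin.cases ⟨m, by simp⟩ (fun i => ?_) i
      obtain ⟨x, hx, h⟩ := hα i
      exact ⟨x, by omega, by simpa [Function.update_of_ne hx.ne] using h⟩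
    · intro φ h1 h2
      have := hπ _ _ ⟨φ, h1, h2, rfl, rfl⟩ v
      split_ifs at this <;> simp_all

theorem game_iff_cEquivalent (k : ℕ) :
    Game k (Fin.elim0 : Fin 0 → G.V) (Fin.elim0 : Fin 0 → G'.V) ↔ CEquivalent k G G' := by
  constructor
  · intro h φ _ hr
    exact Game.sat_iff φ h (fun _ => Or.inl ⟨rfl, rfl⟩) hr
  · intro h
    refine game_of_sat_iff (m := 0) k _ _ (fun _ => none) (fun _ => none) (fun i => i.elim0) ?_
    intro φ hφ hr
    exact h φ (by simpa [Formula.IsSentence] using hφ) hr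

end Game

/-! ### Graphs over a context of labels -/

/-- A graph on `X` together with adjacencies to `n` further labels. -/
structure CtxGraph (Γ : Type u) (n : ℕ) (X : Type w) where
  colour : X → Γ
  adj : X → X → Prop
  ctx : X → Fin n → Prop

/-! ### Operations on forests. -/

/-- The restriction of a forest along an injective map. -/
def Forest.comap {X Y : Type*} (S : Forest X) (f : Y → X) (hf : Function.Injective f) :
    Forest Y where
  le a b := S.le (f a) (f b)
  isPartialOrder :=
    { refl := fun a => S.isPartialOrder.refl (f a)
      trans := fun a b c => S.isPartialOrder.trans (f a) (f b) (f c)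
      antisymm := fun _ _ h h' => hf (S.isPartialOrder.antisymm _ _ h h') }
  isChain_down t _ ha _ hb hab := S.isChain_down (f t) ha hb (hf.ne hab)

/-- The disjoint union of two forests. -/
def Forest.sum {X Y : Type*} (S : Forest X) (T : Forest Y) : Forest (X ⊕ Y) where
  le := Sum.LiftRel S.le T.le
  isPartialOrder :=
    { refl := by
        rintro (a | a)
        · exact .inl (S.isPartialOrder.refl a)
        · exact .inr (T.isPartialOrder.refl a)
      trans := by
        rintro _ _ _ (h | h) (h' | h')
        · exact .inl (S.isPartialOrder.trans _ _ _ h h')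
        · exact .inr (T.isPartialOrder.trans _ _ _ h h')
      antisymm := by
        rintro _ _ (h | h) (h' | h')
        · exact congrArg _ (S.isPartialOrder.antisymm _ _ h h')
        · exact congrArg _ (T.isPartialOrder.antisymm _ _ h h') }
  isChain_down := by
    rintro (t | t) (a | a) ha (b | b) hb hab
    all_goals simp only [Set.mem_ofPred_eq, Sum.liftRel_inl_inl, Sum.liftRel_inr_inr,
      Sum.not_liftRel_inl_inr, Sum.not_liftRel_inr_inl] at ha hb ⊢
    · exact S.isChain_down t ha hb fun h => hab (congrArg _ h)
    · exact T.isChain_down t ha hb fun h => hab (congrArg _ h)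

/-- The order of a forest with a new root below everything. -/
def Forest.rootLE {X : Type*} (S : Forest X) : Option X → Option X → Prop
  | none, _ => True
  | some _, none => False
  | some a, some b => S.le a b

/-- The tree obtained from a forest by adding a root. -/
def Forest.root {X : Type*} (S : Forest X) : Forest (Option X) where
  le := S.rootLE
  isPartialOrder :=
    { refl := by
        rintro (_ | a)
        · trivial
        · exact S.isPartialOrder.refl a
      trans := by
        rintro (_ | a) (_ | b) (_ | c) h h'
        all_goals first
          | trivial
          | exact h.elim
          | exact h'.elim
          | exact S.isPartialOrder.trans _ _ _ h h'
      antisymm := by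
        rintro (_ | a) (_ | b) h h'
        · rfl
        · exact h'.elim
        · exact h.elim
        · exact congrArg _ (S.isPartialOrder.antisymm _ _ h h') }
  isChain_down := by
    rintro (_ | t) (_ | a) ha (_ | b) hb hab
    all_goals first
      | exact Or.inl trivial
      | exact Or.inr trivial
      | exact ha.elim
      | exact S.isChain_down t ha hb fun h => hab (congrArg _ h)

namespace CtxGraph

variable {Γ : Type u} {n : ℕ} {X Y : Type w}

/-- Homomorphisms into `G` extending the assignment `a` of the labels. -/
structure IsHom (R : CtxGraph Γ n X) (G : ColouredGraph.{u, v} Γ) (a : Fin n → G.V)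
    (h : X → G.V) : Prop where
  map_colour : ∀ x, R.colour x = G.colour (h x)
  map_adj : ∀ x y, R.adj x y → G.graph.Adj (h x) (h y)
  map_ctx : ∀ x i, R.ctx x i → G.graph.Adj (h x) (a i)

/-- The number of homomorphisms into `G` extending `a`. -/
noncomputable def count (R : CtxGraph Γ n X) (G : ColouredGraph.{u, v} Γ) (a : Fin n → G.V) : ℕ :=
  Nat.card {h : X → G.V // R.IsHom G a h}

/-- `R` has an elimination forest of height at most `r`, certified by a level function. -/
def HasDepth (R : CtxGraph Γ n X) (r : ℕ) : Prop :=
  (∀ x, ¬ R.adj x x) ∧ ∃ S : Forest X, (∀ x y, R.adj x y → S.le x y ∨ S.le y x) ∧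
    ∃ lvl : X → ℕ, (∀ x y, S.le x y → x ≠ y → lvl x < lvl y) ∧ ∀ x, lvl x < r

theorem HasDepth.mono {R : CtxGraph Γ n X} {r s : ℕ} (h : R.HasDepth r) (hrs : r ≤ s) :
    R.HasDepth s := by
  obtain ⟨h1, S, h2, lvl, h3, h4⟩ := h
  exact ⟨h1, S, h2, lvl, h3, fun x => (h4 x).trans_le hrs⟩

/-- The graph induced along a map. -/
def comap (R : CtxGraph Γ n X) (f : Y → X) : CtxGraph Γ n Y where
  colour y := R.colour (f y)
  adj x y := R.adj (f x) (f y)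
  ctx y := R.ctx (f y)

theorem HasDepth.comap {R : CtxGraph Γ n X} {r : ℕ} (h : R.HasDepth r) (f : Y → X)
    (hf : Function.Injective f) : (R.comap f).HasDepth r := by
  obtain ⟨h1, S, h2, lvl, h3, h4⟩ := h
  exact ⟨fun x => h1 _, S.comap f hf, fun x y => h2 _ _, fun y => lvl (f y),
    fun x y h hne => h3 _ _ h (hf.ne hne), fun x => h4 _⟩

/-- The disjoint union. -/
def sum (R : CtxGraph Γ n X) (T : CtxGraph Γ n Y) : CtxGraph Γ n (X ⊕ Y) where
  colour := Sum.elim R.colour T.colour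
  adj := Sum.LiftRel R.adj T.adj
  ctx := Sum.elim R.ctx T.ctx

theorem HasDepth.sum {R : CtxGraph Γ n X} {T : CtxGraph Γ n Y} {r : ℕ} (hR : R.HasDepth r)
    (hT : T.HasDepth r) : (R.sum T).HasDepth r := by
  obtain ⟨h1, S, h2, lvl, h3, h4⟩ := hR
  obtain ⟨h1', S', h2', lvl', h3', h4'⟩ := hT
  refine ⟨?_, S.sum S', ?_, Sum.elim lvl lvl', ?_, ?_⟩
  · rintro (x | x) h
    · exact h1 x (Sum.liftRel_inl_inl.1 h)
    · exact h1' x (Sum.liftRel_inr_inr.1 h)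
  · rintro _ _ (h | h)
    · exact (h2 _ _ h).imp .inl .inl
    · exact (h2' _ _ h).imp .inr .inr
  · rintro _ _ (h | h) hne
    · exact h3 _ _ h fun e => hne (congrArg _ e)
    · exact h3' _ _ h fun e => hne (congrArg _ e)
  · rintro (x | x)
    · exact h4 x
    · exact h4' x

/-- The graph without vertices. -/
def empty (Γ : Type u) (n : ℕ) : CtxGraph Γ n PEmpty.{w + 1} where
  colour := PEmpty.elim
  adj := fun x => x.elim
  ctx := fun x => x.elim

theorem hasDepth_empty (r : ℕ) : (empty.{u, w} Γ n).HasDepth r :=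
  ⟨fun x => x.elim,
    { le := fun x => x.elim
      isPartialOrder :=
        { refl := fun x => x.elim
          trans := fun x => x.elim
          antisymm := fun x => x.elim }
      isChain_down := fun x => x.elim },
    fun x => x.elim, fun x => x.elim, fun x => x.elim, fun x => x.elim⟩

/-- Adjacency after turning the label `0` into a vertex. -/
def bindAdj (R : CtxGraph Γ (n + 1) X) : Option X → Option X → Prop
  | none, none => False
  | none, some x => R.ctx x 0
  | some _, none => False
  | some x, some y => R.adj x y

/-- Turn the label `0` into a vertex of colour `c` that is adjacent to the labels in `A`. -/
def bind (R : CtxGraph Γ (n + 1) X) (c : Γ) (A : Set (Fin n)) : CtxGraph Γ n (Option X) where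
  colour x := x.elim c R.colour
  adj := R.bindAdj
  ctx x := x.elim (· ∈ A) fun x i => R.ctx x i.succ

theorem HasDepth.bind {R : CtxGraph Γ (n + 1) X} {r : ℕ} (h : R.HasDepth r) (c : Γ)
    (A : Set (Fin n)) : (R.bind c A).HasDepth (r + 1) := by
  obtain ⟨h1, S, h2, lvl, h3, h4⟩ := h
  refine ⟨?_, S.root, ?_, fun x => x.elim 0 fun x => lvl x + 1, ?_, ?_⟩
  · rintro (_ | x) h
    · exact h
    · exact h1 x h
  · rintro (_ | x) (_ | y) h
    · exact Or.inl trivial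
    · exact Or.inl trivial
    · exact Or.inr trivial
    · exact h2 x y h
  · rintro (_ | x) (_ | y) h hne
    · exact absurd rfl hne
    · exact Nat.succ_pos _
    · exact h.elim
    · exact Nat.succ_lt_succ (h3 x y h fun e => hne (congrArg _ e))
  · rintro (_ | x)
    · exact Nat.succ_pos _
    · exact Nat.succ_lt_succ (h4 x)

/-- Turn the vertex `none` into the label `0`. -/
def unbind (R : CtxGraph Γ n (Option X)) : CtxGraph Γ (n + 1) X where
  colour x := R.colour (some x)
  adj x y := R.adj (some x) (some y)
  ctx x := Fin.cons (R.adj none (some x) ∨ R.adj (some x) none) (R.ctx (some x))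

/-- `bind` records edges at the new vertex in one direction only, so the disjunction in `unbind`
collapses. -/
theorem unbind_bind (R : CtxGraph Γ (n + 1) X) (c : Γ) (A : Set (Fin n)) :
    (R.bind c A).unbind = R := by
  rcases R with ⟨colour, adj, ctx⟩
  simp only [unbind, bind, bindAdj, CtxGraph.mk.injEq, Option.elim_some, true_and, or_false]
  funext x i
  refine Fin.cases ?_ (fun i => ?_) i <;> simp

/-- Substitute labels for labels. -/
def rename {m : ℕ} (R : CtxGraph Γ n X) (f : Fin n → Fin m) : CtxGraph Γ m X where
  colour := R.colour
  adj := R.adj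
  ctx x i := ∃ j, f j = i ∧ R.ctx x j

theorem HasDepth.rename {m : ℕ} {R : CtxGraph Γ n X} {r : ℕ} (h : R.HasDepth r)
    (f : Fin n → Fin m) : (R.rename f).HasDepth r := h

/-! ### Identities for homomorphism counts. -/

variable (G : ColouredGraph.{u, v} Γ)

theorem count_rename {m : ℕ} (R : CtxGraph Γ n X) (f : Fin n → Fin m) (a : Fin m → G.V) :
    (R.rename f).count G a = R.count G (a ∘ f) := by
  refine Nat.card_congr (Equiv.subtypeEquivRight fun h => ?_)
  constructor
  · rintro ⟨h1, h2, h3⟩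
    exact ⟨h1, h2, fun x i hi => h3 x _ ⟨i, rfl, hi⟩⟩
  · rintro ⟨h1, h2, h3⟩
    refine ⟨h1, h2, ?_⟩
    rintro x _ ⟨j, rfl, hj⟩
    exact h3 x j hj

theorem count_of_isEmpty [IsEmpty X] (R : CtxGraph Γ n X) (a : Fin n → G.V) :
    R.count G a = 1 := by
  have : Unique {h : X → G.V // R.IsHom G a h} :=
    { default := ⟨isEmptyElim, ⟨isEmptyElim, isEmptyElim, isEmptyElim⟩⟩
      uniq := fun h => Subtype.ext (funext isEmptyElim) }
  exact Nat.card_unique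

theorem count_comap_equiv (R : CtxGraph Γ n X) (e : Y ≃ X) (a : Fin n → G.V) :
    (R.comap e).count G a = R.count G a := by
  refine Nat.card_congr (Equiv.subtypeEquiv (e.arrowCongr (Equiv.refl _)) fun h => ?_)
  constructor
  · rintro ⟨h1, h2, h3⟩
    refine ⟨fun x => ?_, fun x y hxy => ?_, fun x i hi => ?_⟩
    · simpa [comap] using h1 (e.symm x)
    · simpa using h2 (e.symm x) (e.symm y) (by simpa [comap] using hxy)
    · simpa using h3 (e.symm x) i (by simpa [comap] using hi)
  · rintro ⟨h1, h2, h3⟩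
    refine ⟨fun x => ?_, fun x y hxy => ?_, fun x i hi => ?_⟩
    · simpa [comap] using h1 (e x)
    · simpa using h2 (e x) (e y) hxy
    · simpa using h3 (e x) i hi

/-- Homomorphism counts are multiplicative over disjoint unions. -/
theorem count_sum_type (R : CtxGraph Γ n (X ⊕ Y))
    (h1 : ∀ x y, ¬ R.adj (.inl x) (.inr y)) (h2 : ∀ x y, ¬ R.adj (.inr y) (.inl x))
    (a : Fin n → G.V) :
    R.count G a = (R.comap Sum.inl).count G a * (R.comap Sum.inr).count G a := by
  rw [count, count, count, ← Nat.card_prod]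
  refine Nat.card_congr
    { toFun := fun h => (⟨h.1 ∘ .inl, ?_⟩, ⟨h.1 ∘ .inr, ?_⟩)
      invFun := fun p => ⟨Sum.elim p.1.1 p.2.1, ?_⟩
      left_inv := fun h => Subtype.ext (Sum.elim_comp_inl_inr h.1)
      right_inv := fun p => rfl }
  · exact ⟨fun x => h.2.1 _, fun x y => h.2.2 _ _, fun x => h.2.3 _⟩
  · exact ⟨fun x => h.2.1 _, fun x y => h.2.2 _ _, fun x => h.2.3 _⟩
  · obtain ⟨⟨f, hf⟩, ⟨g, hg⟩⟩ := p
    refine ⟨?_, ?_, ?_⟩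
    · rintro (x | x)
      · exact hf.1 x
      · exact hg.1 x
    · rintro (x | x) (y | y) h
      · exact hf.2 x y h
      · exact (h1 _ _ h).elim
      · exact (h2 _ _ h).elim
      · exact hg.2 x y h
    · rintro (x | x) i h
      · exact hf.3 x i h
      · exact hg.3 x i h

theorem count_sum (R : CtxGraph Γ n X) (T : CtxGraph Γ n Y) (a : Fin n → G.V) :
    (R.sum T).count G a = R.count G a * T.count G a := by
  rw [count_sum_type G (R.sum T) (fun x y => Sum.not_liftRel_inl_inr)
    (fun x y => Sum.not_liftRel_inr_inl)]
  simp [comap, sum]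

open Classical in
/-- Homomorphism counts sum over the image of a distinguished vertex. -/
theorem count_option_type [Finite X] (R : CtxGraph Γ n (Option X)) (h0 : ¬ R.adj none none)
    (a : Fin n → G.V) :
    R.count G a = ∑ v, if R.colour none = G.colour v ∧ ∀ i, R.ctx none i → G.graph.Adj v (a i)
      then R.unbind.count G (Fin.cons v a : Fin (n + 1) → G.V) else 0 := by
  rw [← Finset.sum_filter, ← Finset.sum_subtype_eq_sum_filter, Finset.subtype_univ]
  simp only [count]
  rw [← Nat.card_sigma]
  refine Nat.card_congr
    { toFun := fun h => ⟨⟨h.1 none, h.2.1 none, h.2.3 none⟩, ⟨fun x => h.1 (some x), ?_⟩⟩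
      invFun := fun p => ⟨fun x => x.elim p.1.1 p.2.1, ?_⟩
      left_inv := fun h => Subtype.ext (funext fun x => by cases x <;> rfl)
      right_inv := fun p => rfl }
  · refine ⟨fun x => h.2.1 _, fun x y => h.2.2 _ _, fun x i => ?_⟩
    refine Fin.cases ?_ (fun i => ?_) i
    · rintro (hx | hx)
      · exact (h.2.2 _ _ hx).symm
      · exact h.2.2 _ _ hx
    · exact h.2.3 _ _
  · obtain ⟨⟨v, hv1, hv2⟩, ⟨f, hf⟩⟩ := p
    refine ⟨?_, ?_, ?_⟩
    · rintro (_ | x)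
      · exact hv1
      · exact hf.1 x
    · rintro (_ | x) (_ | y) h
      · exact (h0 h).elim
      · exact (hf.3 y 0 (Or.inl h)).symm
      · exact hf.3 x 0 (Or.inr h)
      · exact hf.2 x y h
    · rintro (_ | x) i h
      · exact hv2 i h
      · exact hf.3 x i.succ h

open Classical in
theorem count_bind [Finite X] (R : CtxGraph Γ (n + 1) X) (c : Γ) (A : Set (Fin n))
    (a : Fin n → G.V) :
    (R.bind c A).count G a = ∑ v, if c = G.colour v ∧ ∀ i ∈ A, G.graph.Adj v (a i)
      then R.count G (Fin.cons v a : Fin (n + 1) → G.V) else 0 := by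
  rw [count_option_type G (R.bind c A) id, unbind_bind]
  rfl

end CtxGraph

/-! ### The game and homomorphism counts. -/

section Equivalence

variable {Γ : Type u} {G : ColouredGraph.{u, v} Γ} {G' : ColouredGraph.{u, v'} Γ}

/-- Induction on the number of vertices: split off the tree above a root `x`. The remaining vertices
keep the position and the depth; in the tree, the image of `x` is Duplicator's next pair and the
depth drops by one. -/
theorem Game.count_eq (N : ℕ) : ∀ (X : Type w) [Finite X], Nat.card X = N → ∀ {r n : ℕ}
    (R : CtxGraph Γ n X) {a : Fin n → G.V} {a' : Fin n → G'.V}, R.HasDepth r → Game r a a' →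
    R.count G a = R.count G' a' := by
  classical
  induction N using Nat.strong_induction_on with
  | _ N ih =>
    rintro X _ rfl r n R a a' hR hg
    rcases isEmpty_or_nonempty X with hX | hX
    · rw [CtxGraph.count_of_isEmpty, CtxGraph.count_of_isEmpty]
    obtain ⟨hirr, S, helim, lvl, hlvl, hlt⟩ := id hR
    -- A vertex of least level is a root of the forest.
    obtain ⟨x, hx⟩ := Finite.exists_min lvl
    have hmin : ∀ y, S.le y x → y = x := fun y hy => by
      by_contra hne
      exact absurd (hlvl y x hy hne) (not_lt.2 (hx y))
    obtain ⟨r, rfl⟩ : ∃ s, r = s + 1 := Nat.exists_eq_succ_of_ne_zero (by have := hlt x; omega)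
    let C := {y : X // S.le x y ∧ y ≠ x}
    let D := {y : X // ¬ S.le x y}
    let f : Option C ⊕ D → X := Sum.elim (fun o => o.elim x Subtype.val) Subtype.val
    have hup : ∀ o : Option C, S.le x (f (.inl o)) := by
      rintro (_ | y)
      · exact S.isPartialOrder.refl x
      · exact y.2.1
    have hf : Function.Bijective f := by
      constructor
      · rintro ((_ | y) | y) ((_ | z) | z) h
        · rfl
        · exact (z.2.2 h.symm).elim
        · exact (z.2 ((show x = z.1 from h) ▸ S.isPartialOrder.refl x)).elim
        · exact (y.2.2 h).elim
        · exact congrArg _ (congrArg _ (Subtype.ext h))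
        · exact (z.2 ((show y.1 = z.1 from h) ▸ y.2.1)).elim
        · exact (y.2 ((show y.1 = x from h).symm ▸ S.isPartialOrder.refl x)).elim
        · exact (y.2 ((show y.1 = z.1 from h).symm ▸ z.2.1)).elim
        · exact congrArg _ (Subtype.ext h)
      · intro y
        by_cases h1 : S.le x y
        · by_cases h2 : y = x
          · exact ⟨.inl none, h2.symm⟩
          · exact ⟨.inl (some ⟨y, h1, h2⟩), rfl⟩
        · exact ⟨.inr ⟨y, h1⟩, rfl⟩
    have hcross : ∀ (o : Option C) (y : D), ¬ (S.le (f (.inl o)) y.1 ∨ S.le y.1 (f (.inl o))) := by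
      rintro o y (h | h)
      · exact y.2 (S.isPartialOrder.trans _ _ _ (hup o) h)
      · by_cases hxy : x = y.1
        · exact y.2 (hxy ▸ S.isPartialOrder.refl x)
        -- Both `x` and `y` lie below the same vertex, hence are comparable; this is where the
        -- forest property enters.
        · rcases S.isChain_down _ (hup o) h hxy with h' | h'
          · exact y.2 h'
          · exact hxy (hmin _ h').symm
    have hcard : Nat.card X = Nat.card C + 1 + Nat.card D := by
      rw [← Nat.card_congr (Equiv.ofBijective f hf), Nat.card_sum, Finite.card_option]
    let e : Option C ⊕ D ≃ X := Equiv.ofBijective f hf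
    let T : CtxGraph Γ n (Option C) := (R.comap e).comap Sum.inl
    have hc1 : ∀ o y, ¬ (R.comap e).adj (.inl o) (.inr y) := fun o y h =>
      hcross o y (helim _ _ h)
    have hc2 : ∀ o y, ¬ (R.comap e).adj (.inr y) (.inl o) := fun o y h =>
      hcross o y (helim _ _ h).symm
    have hD : ((R.comap e).comap Sum.inr).HasDepth (r + 1) :=
      (hR.comap e e.injective).comap _ Sum.inr_injective
    -- Vertices strictly above `x` have positive level, so the truncated subtraction in `lvl - 1`
    -- preserves strict inequalities.
    have hC : T.unbind.HasDepth r := by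
      refine ⟨fun y => hirr _, S.comap Subtype.val Subtype.val_injective, fun y z => helim _ _,
        fun y => lvl y.1 - 1, fun y z h hne => ?_, fun y => ?_⟩
      · have h1 := hlvl y.1 z.1 h (Subtype.val_injective.ne hne)
        have h2 := hlvl x y.1 y.2.1 y.2.2.symm
        change lvl y.1 - 1 < lvl z.1 - 1
        omega
      · have h1 := hlt y.1
        have h2 := hlvl x y.1 y.2.1 y.2.2.symm
        change lvl y.1 - 1 < r
        omega
    obtain ⟨-, π, hπ⟩ := id hg
    rw [← CtxGraph.count_comap_equiv G R e, ← CtxGraph.count_comap_equiv G' R e,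
      CtxGraph.count_sum_type G _ hc1 hc2, CtxGraph.count_sum_type G' _ hc1 hc2,
      ih (Nat.card D) (by omega) D rfl _ hD hg]
    congr 1
    change T.count G a = T.count G' a'
    rw [CtxGraph.count_option_type G T (hirr x), CtxGraph.count_option_type G' T (hirr x)]
    refine Fintype.sum_equiv π _ _ fun v => ?_
    obtain ⟨-, hadj, hcol⟩ := (hπ v).partialIso
    have h1 : G.colour v = G'.colour (π v) := hcol 0
    have h2 : ∀ i, G.graph.Adj v (a i) ↔ G'.graph.Adj (π v) (a' i) := fun i => hadj 0 i.succ
    simp only [h1, h2, ih (Nat.card C) (by omega) C rfl _ hC (hπ v)]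

theorem comp_cons_id {V : Type*} {n : ℕ} (b : Fin n → V) (i : Fin n) :
    b ∘ (Fin.cons i id : Fin (n + 1) → Fin n) = Fin.cons (b i) b := by
  funext j
  refine Fin.cases ?_ (fun j => ?_) j <;> simp

-- The functions count homomorphisms with the new vertex as label `0`, guarded by its colour and by
-- adjacencies to the old labels. The guard is what `bind` encodes in the new root.
open Classical in
theorem game_of_count_eq (r : ℕ) : ∀ {n : ℕ} (a : Fin n → G.V) (a' : Fin n → G'.V),
    PartialIso a a' →
    (∀ (X : Type w) [Finite X] (R : CtxGraph Γ n X), R.HasDepth r →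
      R.count G a = R.count G' a') → Game r a a' := by
  induction r with
  | zero => intro n a a' h _; exact h
  | succ r ih =>
    intro n a a' hp hc
    refine ⟨hp, ?_⟩
    let φ : ∀ (c : Γ) (A : Set (Fin n)) (X : Type w) (_ : CtxGraph Γ (n + 1) X), G.V → ℤ :=
      fun c A X R v => if c = G.colour v ∧ ∀ i ∈ A, G.graph.Adj v (a i)
        then (R.count G (Fin.cons v a : Fin (n + 1) → G.V) : ℤ) else 0
    let ψ : ∀ (c : Γ) (A : Set (Fin n)) (X : Type w) (_ : CtxGraph Γ (n + 1) X), G'.V → ℤ :=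
      fun c A X R v => if c = G'.colour v ∧ ∀ i ∈ A, G'.graph.Adj v (a' i)
        then (R.count G' (Fin.cons v a' : Fin (n + 1) → G'.V) : ℤ) else 0
    -- The zero pair is needed for closure under products: guards with different colours exclude
    -- each other.
    let P : (G.V → ℤ) → (G'.V → ℤ) → Prop := fun f g => (f = 0 ∧ g = 0) ∨
      ∃ (c : Γ) (A : Set (Fin n)) (X : Type w) (_ : Finite X) (R : CtxGraph Γ (n + 1) X),
        R.HasDepth r ∧ f = φ c A X R ∧ g = ψ c A X R
    have hP : ∀ (c : Γ) (A : Set (Fin n)) (X : Type w) [Finite X] (R : CtxGraph Γ (n + 1) X),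
        R.HasDepth r → P (φ c A X R) (ψ c A X R) := fun c A X _ R h =>
      Or.inr ⟨c, A, X, inferInstance, R, h, rfl, rfl⟩
    obtain ⟨π, hπ⟩ := exists_equiv_of_sum_eq P
      (by
        rintro _ _ _ _ (⟨rfl, rfl⟩ | ⟨c, A, X, _, R, hR, rfl, rfl⟩)
          (⟨rfl, rfl⟩ | ⟨d, B, Y, _, T, hT, rfl, rfl⟩)
        · exact Or.inl ⟨mul_zero _, mul_zero _⟩
        · exact Or.inl ⟨zero_mul _, zero_mul _⟩
        · exact Or.inl ⟨mul_zero _, mul_zero _⟩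
        by_cases hcd : c = d
        · subst hcd
          refine Or.inr ⟨c, A ∪ B, X ⊕ Y, inferInstance, R.sum T, hR.sum hT, ?_, ?_⟩ <;>
          · funext v
            simp only [φ, ψ, Pi.mul_apply, CtxGraph.count_sum, Set.mem_union, or_imp,
              forall_and, Nat.cast_mul]
            split_ifs <;> simp_all
        · refine Or.inl ⟨?_, ?_⟩ <;>
          · funext v
            simp only [φ, ψ, Pi.mul_apply, Pi.zero_apply]
            split_ifs with h1 h2
            · exact (hcd (h1.1.trans h2.1.symm)).elim
            all_goals simp)
      (by
        rintro _ _ (⟨rfl, rfl⟩ | ⟨c, A, X, _, R, hR, rfl, rfl⟩)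
        · simp
        · have := hc _ (R.bind c A) (hR.bind c A)
          rw [CtxGraph.count_bind, CtxGraph.count_bind] at this
          simp only [φ, ψ]
          exact_mod_cast this)
      (fun v => ⟨_, _, hP (G.colour v) ∅ _ _ (CtxGraph.hasDepth_empty r), by
        simp [φ, CtxGraph.count_of_isEmpty]⟩)
      (fun v => ⟨_, _, hP (G'.colour v) ∅ _ _ (CtxGraph.hasDepth_empty r), by
        simp [ψ, CtxGraph.count_of_isEmpty]⟩)
    -- The counts need not determine whether `v` equals some `a i`, so the bijection is changed to
    -- send `a i` to `a' i`.
    obtain ⟨ρ, hρ, hρa⟩ := exists_equiv_extending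
      (fun (v : G.V) (p : {p : (G.V → ℤ) × (G'.V → ℤ) // P p.1 p.2}) => p.1.1 v)
      (fun v p => p.1.2 v) π (fun v => funext fun p => (hπ _ _ p.2 v).symm) a a' hp.1
      (by
        rintro i
        funext ⟨⟨f, g⟩, h⟩
        change g (a' i) = f (a i)
        change P f g at h
        obtain ⟨rfl, rfl⟩ | ⟨c, A, X, _, R, hR, rfl, rfl⟩ := h
        · rfl
        -- When the new vertex is `a i`, label `0` can be merged into label `i`; no root is added,
        -- so the count is covered by `hc`.
        · have h1 := hc X (R.rename (Fin.cons i id)) ((hR.rename _).mono (Nat.le_succ r))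
          rw [CtxGraph.count_rename, CtxGraph.count_rename] at h1
          rw [comp_cons_id, comp_cons_id] at h1
          simp only [φ, ψ, hp.2.1, hp.2.2, h1])
    have hval : ∀ (v : G.V) (c : Γ) (A : Set (Fin n)) (X : Type w) [Finite X]
        (R : CtxGraph Γ (n + 1) X), R.HasDepth r → ψ c A X R (ρ v) = φ c A X R v :=
      fun v c A X _ R h => congrFun (hρ v) ⟨(_, _), hP c A X R h⟩
    have hcol : ∀ v, G.colour v = G'.colour (ρ v) := by
      intro v
      -- For the empty graph only the guard remains, here the indicator of a colour; below, `{i}`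
      -- also tests adjacency to `a i`.
      have := hval v (G.colour v) ∅ _ _ (CtxGraph.hasDepth_empty r)
      by_contra hne
      simp [φ, ψ, CtxGraph.count_of_isEmpty, hne] at this
    have hadj : ∀ v i, G.graph.Adj v (a i) ↔ G'.graph.Adj (ρ v) (a' i) := by
      intro v i
      have := hval v (G.colour v) {i} _ _ (CtxGraph.hasDepth_empty r)
      simp only [φ, ψ, CtxGraph.count_of_isEmpty, ← hcol, Set.mem_singleton_iff, forall_eq,
        true_and] at this
      split_ifs at this <;> simp_all
    refine ⟨ρ, fun v => ih _ _ ⟨fun i j => ?_, fun i j => ?_, fun i => ?_⟩ fun X _ R hR => ?_⟩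
    · have hq : ∀ j, v = a j ↔ ρ v = a' j := fun j => by
        rw [← hρa j, ρ.injective.eq_iff]
      refine Fin.cases ?_ (fun i => ?_) i <;> refine Fin.cases ?_ (fun j => ?_) j
      · simp
      · simpa using hq j
      · simpa [eq_comm] using hq i
      · simpa using hp.1 i j
    · refine Fin.cases ?_ (fun i => ?_) i <;> refine Fin.cases ?_ (fun j => ?_) j
      · simp
      · simpa using hadj v j
      · simpa [SimpleGraph.adj_comm] using hadj v i
      · simpa using hp.2.1 i j
    · refine Fin.cases ?_ (fun i => ?_) i
      · exact hcol v
      · exact hp.2.2 i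
    · have := hval v (G.colour v) ∅ X R hR
      simp only [φ, ψ, ← hcol, Set.mem_empty_iff_false, false_imp_iff, implies_true, and_self,
        if_true] at this
      exact_mod_cast this.symm

/-! ### Translation between label-free context graphs and coloured graphs. -/

/-- A context graph without labels as a coloured graph. -/
def CtxGraph.toColouredGraph {X : Type w} [Finite X] (R : CtxGraph Γ 0 X) :
    ColouredGraph.{u, w} Γ where
  V := X
  finite_V := inferInstance
  graph := SimpleGraph.fromRel R.adj
  colour := R.colour

/-- Symmetrizing `adj` adds no constraint because adjacency in `G` is symmetric, and dropping loops
loses none because `HasDepth` forbids them. -/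
theorem CtxGraph.HasDepth.homCount_toColouredGraph {X : Type w} [Finite X] {R : CtxGraph Γ 0 X}
    {r : ℕ} (hR : R.HasDepth r) (G : ColouredGraph.{u, v} Γ) :
    homCount R.toColouredGraph G = R.count G Fin.elim0 := by
  refine Nat.card_congr (Equiv.subtypeEquivRight fun h => ?_)
  constructor
  · rintro ⟨h1, h2⟩
    refine ⟨h2, fun x y hxy => h1 x y ?_, fun x i => i.elim0⟩
    refine (SimpleGraph.fromRel_adj _ _ _).2 ⟨?_, Or.inl hxy⟩
    rintro rfl
    exact hR.1 _ hxy
  · rintro ⟨h1, h2, -⟩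
    refine ⟨fun x y hxy => ?_, h1⟩
    rcases ((SimpleGraph.fromRel_adj _ _ _).1 hxy).2 with h' | h'
    · exact h2 _ _ h'
    · exact (h2 _ _ h').symm

theorem CtxGraph.HasDepth.treeDepth_le {X : Type w} [Finite X] {R : CtxGraph Γ 0 X}
    {r : ℕ} (hR : R.HasDepth r) : treeDepth R.toColouredGraph ≤ r := by
  obtain ⟨-, S, h2, lvl, h3, h4⟩ := hR
  have helim : IsEliminationForest R.toColouredGraph S := by
    intro x y hxy
    rcases ((SimpleGraph.fromRel_adj _ _ _).1 hxy).2 with h' | h'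
    · exact h2 _ _ h'
    · exact (h2 _ _ h').symm
  refine (Nat.sInf_le ⟨S, helim, rfl⟩ : treeDepth R.toColouredGraph ≤ S.height).trans ?_
  refine csSup_le ⟨0, ∅, by simp, rfl⟩ ?_
  rintro _ ⟨Z, hZ, rfl⟩
  rw [← Finset.card_range r]
  -- Levels are strictly monotone, hence injective on chains.
  refine Finset.card_le_card_of_injOn lvl (fun x _ => by simpa using h4 x) ?_
  intro x hx y hy hxy
  by_contra hne
  rcases hZ hx hy hne with h | h
  · exact (h3 _ _ h hne).ne hxy
  · exact (h3 _ _ h (Ne.symm hne)).ne hxy.symm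

/-- A coloured graph as a context graph without labels. -/
def ColouredGraph.toCtxGraph (F : ColouredGraph.{u, w} Γ) : CtxGraph Γ 0 F.V where
  colour := F.colour
  adj := F.graph.Adj
  ctx _ i := i.elim0

theorem ColouredGraph.count_toCtxGraph (F : ColouredGraph.{u, w} Γ) (G : ColouredGraph.{u, v} Γ) :
    F.toCtxGraph.count G Fin.elim0 = homCount F G :=
  Nat.card_congr (Equiv.subtypeEquivRight fun _ =>
    ⟨fun h => ⟨h.2, h.1⟩, fun h => ⟨h.2, h.1, fun _ i => i.elim0⟩⟩)

theorem ColouredGraph.hasDepth_toCtxGraph {F : ColouredGraph.{u, w} Γ} {k : ℕ}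
    (hF : treeDepth F ≤ k) : F.toCtxGraph.HasDepth k := by
  classical
  obtain ⟨S₀, hS₀⟩ := exists_isEliminationForest F
  obtain ⟨S, hS, hh⟩ := Nat.sInf_mem
    (⟨_, S₀, hS₀, rfl⟩ : {d : ℕ | ∃ S : Forest F.V, IsEliminationForest F S ∧ S.height = d}.Nonempty)
  have hk : S.height ≤ k := hh.trans_le hF
  -- The level of `x` is the size of the chain below it, minus one because the chain contains `x`.
  let down : F.V → Finset F.V := fun x => Finset.univ.filter fun y => S.le y x
  have hmem : ∀ x, x ∈ down x := fun x => by simp [down, S.isPartialOrder.refl x]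
  have hpos : ∀ x, 0 < (down x).card := fun x => Finset.card_pos.2 ⟨x, hmem x⟩
  have hle : ∀ x, (down x).card ≤ S.height := fun x => by
    refine le_csSup S.bddAbove_chains ⟨down x, ?_, rfl⟩
    have : (down x : Set F.V) = {y | S.le y x} := by ext y; simp [down]
    rw [this]
    exact S.isChain_down x
  refine ⟨fun x => F.graph.irrefl, S, hS, fun x => (down x).card - 1, fun x y h hne => ?_,
    fun x => ?_⟩
  · have : (down x).card < (down y).card := by
      refine Finset.card_lt_card ⟨fun z hz => ?_, fun hsub => ?_⟩
      · simp only [down, Finset.mem_filter, Finset.mem_univ, true_and] at hz ⊢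
        exact S.isPartialOrder.trans _ _ _ hz h
      · have := hsub (hmem y)
        simp only [down, Finset.mem_filter, Finset.mem_univ, true_and] at this
        exact hne (S.isPartialOrder.antisymm _ _ h this)
    have := hpos x
    change (down x).card - 1 < (down y).card - 1
    omega
  · have := hpos x
    have := hle x
    change (down x).card - 1 < k
    omega

theorem game_iff_homIndistinguishable (k : ℕ) :
    Game k (Fin.elim0 : Fin 0 → G.V) (Fin.elim0 : Fin 0 → G'.V) ↔
      HomIndistinguishable (TD.{u, w} Γ k) G G' := by
  constructor
  · intro h F hF
    rw [← F.count_toCtxGraph G, ← F.count_toCtxGraph G']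
    exact Game.count_eq _ F.V rfl _ (ColouredGraph.hasDepth_toCtxGraph hF) h
  · intro h
    refine game_of_count_eq k _ _
      ⟨fun i => i.elim0, fun i => i.elim0, fun i => i.elim0⟩ fun X _ R hR => ?_
    rw [← hR.homCount_toColouredGraph G, ← hR.homCount_toColouredGraph G']
    exact h _ hR.treeDepth_le

end Equivalence

end TDHom

theorem theorem1 {Γ : Type u} (k : ℕ) (hk : 1 ≤ k)
    (G : TDHom.ColouredGraph.{u, v} Γ) (G' : TDHom.ColouredGraph.{u, v'} Γ) :
    TDHom.HomIndistinguishable (TDHom.TD.{u, w} Γ k) G G' ↔ TDHom.CEquivalent k G G' :=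
  TDHom.game_iff_homIndistinguishable.{u, v, v', w} k |>.symm.trans
    (TDHom.game_iff_cEquivalent k)
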